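/- Let $N$ be a positive integer, let $r_m$ be integers indexed by the positive divisors $m$ of $N$, let $\eta(z)=e^{2\pi i z/24}\prod_{n\ge1}(1-e^{2\pi i nz})$ be the Dedekind eta function on the upper half-plane $\mathbb H$, and put $f(z)=\prod_{0<m\mid N}\eta(mz)^{r_m}$. Suppose that the weight $k=\frac12\sum_{0<m\mid N}r_m$ is an integer. For $\gamma=\begin{pmatrix}a&b\\c&d\end{pmatrix}\in\mathrm{SL}_2(\mathbb Z)$ write $(f|_\gamma)(z)=(cz+d)^{-k}f\left(\frac{az+b}{cz+d}\right)$. Then $f$ is a weakly holomorphic modular form of weight $k$ on $\Gamma_1(N)$ (that is, $f$ is holomorphic on $\mathbb H$ and $f|_\gamma=f$ for all $\gamma\in\Gamma_1(N)$, with no condition imposed at the cusps) if and only if $$\sum_{0<m\mid N} m\,r_m\equiv 0\pmod{24}\quad\text{and}\quad \sum_{0<m\mid N} m\,r_{N/m}\equiv 0\pmod{24}.$$ Furthermore, when this holds, $f$ has a unique Nebentypus character, i.e. there is exactly one Dirichlet character $\chi$ modulo $N$ such that $f|_\gamma=\chi(d)f$ for all $\gamma=\begin{pmatrix}a&b\\c&d\end{pmatrix}\in\Gamma_0(N)$,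 and for every odd integer $d$ coprime to $N$ $$\chi(d)=\left(\frac{(-1)^k s}{d}\right),\qquad s=\prod_{0<m\mid N}m^{r_m}.$$ Here, for integers $m$ and odd $d$, $\left(\frac{m}{d}\right)$ is the Jacobi symbol if $d>0$, and $\left(\frac{m}{d}\right)=\mathrm{sgn}(m)\left(\frac{m}{|d|}\right)$ if $d<0$ (with the convention $\left(\frac{0}{-1}\right)=1$); for a rational number $p/q$ in lowest terms with $q>0$ prime to $d$, $\left(\frac{p/q}{d}\right)=\left(\frac{p}{d}\right)\left(\frac{q}{d}\right)$. -/

import Mathlib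

open UpperHalfPlane CongruenceSubgroup
open scoped MatrixGroups ModularForm Manifold

/-- The eta-quotient `z ↦ ∏_{m ∣ N} η(m z) ^ (r m)` on the upper half-plane. Only the values of `r`
at the positive divisors of `N` matter. -/
noncomputable def etaQuotient (N : ℕ) (r : ℕ → ℤ) : ℍ → ℂ :=
  fun z => ∏ m ∈ N.divisors, ModularForm.eta ((m : ℂ) * (z : ℂ)) ^ r m

/-- A weakly holomorphic modular form of weight `k` on `Γ`: a holomorphic function on the upper
half-plane with `f ∣[k] γ = f` for all `γ ∈ Γ`; no condition is imposed at the cusps. -/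
structure IsWeaklyHolomorphicModularForm (Γ : Subgroup SL(2, ℤ)) (k : ℤ) (f : ℍ → ℂ) : Prop where
  holo : MDifferentiable 𝓘(ℂ) 𝓘(ℂ) f
  slash_eq : ∀ γ ∈ Γ, f ∣[k] γ = f

/-- `χ` is a Nebentypus character of `f` (level `N`, weight `k`): `f ∣[k] γ = χ(d) f` for every
`γ = (a b; c d)` in `Γ₀(N)`. -/
def IsNebentypus (N : ℕ) (k : ℤ) (f : ℍ → ℂ) (χ : DirichletCharacter ℂ N) : Prop :=
  ∀ γ ∈ Gamma0 N, f ∣[k] γ = χ ((γ 1 1 : ℤ) : ZMod N) • f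

/-- The extended Jacobi symbol `(m / d)` for odd `d : ℤ`: the Jacobi symbol if `d > 0`, and
`sgn(m) (m / |d|)` if `d < 0`, with the convention `(0 / -1) = 1`. -/
def extJacobi (m d : ℤ) : ℤ :=
  if d < 0 ∧ m < 0 then -jacobiSym m d.natAbs else jacobiSym m d.natAbs

/-- The extended Jacobi symbol `(x / d)` for a rational `x = p / q` whose denominator `q > 0` is
prime to `d`, extended multiplicatively: `(p / d) (q / d)⁻¹ = (p / d) (q / d)`. -/
def extJacobiRat (x : ℚ) (d : ℤ) : ℤ :=
  extJacobi x.num d * extJacobi (x.den : ℤ) d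

/-- The number `s = ∏_{m ∣ N} m ^ (r m)`, a positive rational. -/
def etaQuotientS (N : ℕ) (r : ℕ → ℤ) : ℚ :=
  ∏ m ∈ N.divisors, (m : ℚ) ^ r m

/-!
The eta function satisfies `η(γz) = ε(γ) √(cz + d) η(z)` on `SL(2, ℤ)`, with an explicit `ε(γ)`: a
Jacobi symbol in `c` and `d` times a 24th root of unity (`etaMultiplier`). The closed formula is
proved by induction on words in the generators, multiplying on the right: `S` acts on the bottom
row by `(c, d) ↦ (d, -c)`, which is quadratic reciprocity together with a branch correction for
the square root (`etaMultiplier_mul_S`), and `T` acts by `(c, d) ↦ (c, c + d)`, which is immediate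
for odd `c` (`etaMultiplier_mul_T`). For even `c` the step by `T` follows from the others through
`T = S T⁻¹ S T⁻¹ S`, so the behaviour of `(c / d)` under `d ↦ d + c` is never needed.

Applied to `η(mz)` for every `m ∣ N`, this shows that `f ∣[k] γ = v(γ) f` for all `γ ∈ Γ₀(N)`
(`etaQuotient_slash`), and `v` is multiplicative because `f` has no zeros. The values of `v` at
`T` and at `L = (1 0; N 1)`, both in `Γ₁(N)`, are `e(∑ m r_m / 24)` and `e(-∑ m r_{N/m} / 24)`, so
the two congruences are necessary. Conversely, under the congruences the explicit formula
collapses, for odd `d` and even `c / N`, to `v(γ) = ((-1)^k s / d)`; multiplying by `L` extends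
this to all odd `d` (`etaQuotientMultiplier_eq_extJacobiRat`). In particular `v` depends only on
`d` when `d` is odd, and comparison with `L T^t` gives `v = 1` on `Γ₁(N)`
(`etaQuotientMultiplier_of_mem_Gamma1`). Hence `v` descends to `Γ₀(N) / Γ₁(N) ≃ (ℤ/N)ˣ`, where it
is the Nebentypus character.
-/

/-! ### The root of unity `e(1/24)`, and `η` under the generators of `SL(2, ℤ)` -/

/-- The primitive 24th root of unity `e ^ (2πi/24)`. -/
noncomputable def zeta24 : ℂ := Complex.exp (2 * Real.pi * Complex.I / 24)

lemma zeta24_ne_zero : zeta24 ≠ 0 := Complex.exp_ne_zero _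

lemma zeta24_zpow_eq_one_iff (n : ℤ) : zeta24 ^ n = 1 ↔ (24 : ℤ) ∣ n := by
  have h : IsPrimitiveRoot zeta24 24 := by
    simpa [zeta24] using Complex.isPrimitiveRoot_exp 24 (by norm_num)
  simpa using h.zpow_eq_one_iff_dvd n

lemma zeta24_zpow_congr {m n : ℤ} (h : (24 : ℤ) ∣ m - n) : zeta24 ^ m = zeta24 ^ n := by
  rw [← sub_add_cancel m n, zpow_add₀ zeta24_ne_zero, (zeta24_zpow_eq_one_iff _).2 h, one_mul]

lemma zeta24_zpow_twelve : zeta24 ^ (12 : ℤ) = -1 := by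
  rw [zeta24, ← Complex.exp_int_mul, ← Complex.exp_pi_mul_I]
  congr 1
  push_cast
  ring

lemma zeta24_zpow_eq_one {n : ℤ} (h : (24 : ℤ) ∣ n) : zeta24 ^ n = 1 :=
  (zeta24_zpow_eq_one_iff n).2 h

lemma zeta24_zpow_eq_neg {m n : ℤ} (h : (24 : ℤ) ∣ m - (n + 12)) :
    zeta24 ^ m = -zeta24 ^ n := by
  rw [zeta24_zpow_congr h, zpow_add₀ zeta24_ne_zero, zeta24_zpow_twelve, mul_neg_one]

lemma sqrt_I_inv : (Complex.sqrt Complex.I)⁻¹ = zeta24 ^ (-3 : ℤ) := by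
  rw [sqrt_eq_exp Complex.I_ne_zero, Complex.log_I, zeta24, ← Complex.exp_int_mul,
    ← Complex.exp_neg]
  congr 1
  push_cast
  ring

lemma eta_neg_inv {z : ℂ} (hz : 0 < z.im) :
    ModularForm.eta (-1 / z) = zeta24 ^ (-3 : ℤ) * Complex.sqrt z * ModularForm.eta z := by
  have := ModularForm.eta_comp_eq_csqrt_I_inv (show z ∈ upperHalfPlaneSet from hz)
  simpa [sqrt_I_inv, mul_assoc] using this

lemma eta_add_intCast (z : ℂ) (n : ℤ) :
    ModularForm.eta (z + n) = zeta24 ^ n * ModularForm.eta z := by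
  have h1 : Function.Periodic.qParam 24 (z + n) =
      zeta24 ^ n * Function.Periodic.qParam 24 z := by
    rw [Function.Periodic.qParam, Function.Periodic.qParam, zeta24, ← Complex.exp_int_mul,
      ← Complex.exp_add]
    congr 1
    push_cast
    ring
  have h2 : Function.Periodic.qParam 1 (z + n) = Function.Periodic.qParam 1 z := by
    simp only [Function.Periodic.qParam, Complex.ofReal_one, div_one]
    exact Complex.exp_eq_exp_iff_exists_int.2 ⟨n, by ring⟩
  simp only [ModularForm.eta, ModularForm.eta_q, h1, h2, mul_assoc]

/-! ### Branches of the square root -/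

lemma sqrt_mul_sqrt_of_le {x y : ℂ} (hx : x ≠ 0) (hy : y ≠ 0)
    (h : x.arg + y.arg ∈ Set.Ioc (-Real.pi) Real.pi) :
    Complex.sqrt x * Complex.sqrt y = Complex.sqrt (x * y) := by
  rw [sqrt_eq_exp hx, sqrt_eq_exp hy, sqrt_eq_exp (mul_ne_zero hx hy),
    Complex.log_mul hx hy h, ← Complex.exp_add]
  congr 1
  ring

lemma sqrt_mul_sqrt_of_gt {x y : ℂ} (hx : x ≠ 0) (hy : y ≠ 0)
    (h : Real.pi < x.arg + y.arg) :
    Complex.sqrt x * Complex.sqrt y = -Complex.sqrt (x * y) := by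
  have hlog : Complex.log (x * y) = Complex.log x + Complex.log y - 2 * Real.pi * Complex.I := by
    have he : Complex.exp (Complex.log x + Complex.log y - 2 * Real.pi * Complex.I) = x * y := by
      rw [Complex.exp_sub, Complex.exp_two_pi_mul_I, div_one, Complex.exp_add, Complex.exp_log hx,
        Complex.exp_log hy]
    rw [← he, Complex.log_exp]
    · simp [Complex.log_im]; linarith
    · simp [Complex.log_im]; linarith [Complex.arg_le_pi x, Complex.arg_le_pi y, Real.pi_pos]
  rw [sqrt_eq_exp hx, sqrt_eq_exp hy, sqrt_eq_exp (mul_ne_zero hx hy),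
    hlog, ← Complex.exp_add,
    show (Complex.log x + Complex.log y - 2 * Real.pi * Complex.I) / 2 =
      Complex.log x / 2 + Complex.log y / 2 - Real.pi * Complex.I by ring,
    Complex.exp_sub, Complex.exp_pi_mul_I]
  ring

lemma im_mul_eq_sin (x y : ℂ) :
    (x * y).im = ‖x‖ * ‖y‖ * Real.sin (x.arg + y.arg) := by
  rw [Real.sin_add, Complex.mul_im]
  linear_combination (-y.im) * Complex.norm_mul_cos_arg x - y.re * Complex.norm_mul_sin_arg x
    - ‖x‖ * Real.cos x.arg * Complex.norm_mul_sin_arg y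
    - ‖x‖ * Real.sin x.arg * Complex.norm_mul_cos_arg y

/-- The branch correction in the cocycle relation for `√(cz + d)` along `γ ↦ γS`: the arguments of
`-c/z + d` and of `z` add up to more than `π` exactly when `d < 0 ≤ c`. -/
lemma sqrt_mul_sqrt_upperHalfPlane {c d : ℤ} (h : c ≠ 0 ∨ d ≠ 0) {z : ℂ} (hz : 0 < z.im) :
    Complex.sqrt (c * (-1 / z) + d) * Complex.sqrt z =
      (if d < 0 ∧ 0 ≤ c then -1 else 1) * Complex.sqrt (d * z + (-c : ℤ)) := by
  have hz0 : z ≠ 0 := by rintro rfl; simp at hz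
  set w : ℂ := c * (-1 / z) + d with hw
  have hwz : w * z = d * z + (-c : ℤ) := by rw [hw]; field_simp; push_cast; ring
  have hwim : w.im = c * (z.im / Complex.normSq z) := by
    simp [hw, neg_div, Complex.inv_im]
  have hq : 0 < z.im / Complex.normSq z := div_pos hz (Complex.normSq_pos.2 hz0)
  have hwzim : (w * z).im = d * z.im := by rw [hwz]; simp
  have hw0 : w ≠ 0 := by
    intro h0
    have h1 : (c : ℝ) = 0 := by
      have : (0 : ℝ) = c * (z.im / Complex.normSq z) := by rw [← hwim, h0]; simp
      rcases mul_eq_zero.1 this.symm with h | h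
      · exact h
      · exact absurd h hq.ne'
    have h2 : (d : ℝ) = 0 := by
      rw [h0, zero_mul] at hwzim
      rcases mul_eq_zero.1 hwzim.symm with h | h
      · exact h
      · exact absurd h hz.ne'
    rcases h with h | h
    · exact h (by exact_mod_cast h1)
    · exact h (by exact_mod_cast h2)
  have hn : 0 < ‖w‖ * ‖z‖ := mul_pos (norm_pos_iff.2 hw0) (norm_pos_iff.2 hz0)
  have hargz : 0 < z.arg := (Complex.arg_nonneg_iff.2 hz.le).lt_of_ne' fun h0 ↦
    hz.ne' (Complex.arg_eq_zero_iff.1 h0).2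
  have hargz' : z.arg < Real.pi := Complex.arg_lt_pi_iff.2 (Or.inr hz.ne')
  have hsin := im_mul_eq_sin w z
  rw [hwzim] at hsin
  have hwle := Complex.arg_le_pi w
  rw [← hwz]
  split_ifs with hcd
  · obtain ⟨hd, hc⟩ := hcd
    have hargw : 0 ≤ w.arg := Complex.arg_nonneg_iff.2 (by rw [hwim]; positivity)
    rw [neg_one_mul]
    refine sqrt_mul_sqrt_of_gt hw0 hz0 ?_
    by_contra! hle
    have h1 := Real.sin_nonneg_of_nonneg_of_le_pi (by linarith) hle
    have h2 : (d : ℝ) * z.im < 0 := mul_neg_of_neg_of_pos (by exact_mod_cast hd) hz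
    have h3 := mul_nonneg hn.le h1
    linarith
  · rw [one_mul]
    refine sqrt_mul_sqrt_of_le hw0 hz0 ⟨by linarith [Complex.neg_pi_lt_arg w], ?_⟩
    by_contra! hgt
    have h1 : Real.sin (w.arg + z.arg) < 0 := by
      have := Real.sin_pos_of_pos_of_lt_pi (x := w.arg + z.arg - Real.pi) (by linarith)
        (by linarith)
      rw [Real.sin_sub_pi] at this
      linarith
    have h2 : (d : ℝ) * z.im < 0 := hsin ▸ mul_neg_of_pos_of_neg hn h1
    have hd : d < 0 := by
      by_contra! hd
      have : (0 : ℝ) ≤ d * z.im := mul_nonneg (by exact_mod_cast hd) hz.le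
      linarith
    have hc : c < 0 := by
      by_contra! hc
      exact hcd ⟨hd, hc⟩
    have hargw : w.arg < 0 := Complex.arg_neg_iff.2 (by
      rw [hwim]; exact mul_neg_of_neg_of_pos (by exact_mod_cast hc) hq)
    linarith

/-! ### The explicit multiplier of the eta function -/

/-- Petersson's closed formula for the multiplier `ε` of the eta function at `(a b; c d)` in
`SL(2, ℤ)`, normalised by `η(γz) = ε √(cz + d) η(z)` with the principal branch of the square root.
The entries are separate arguments, so that the conjugates `(a, mb; c/m, d)` need no new matrices.
For odd `c` the symbol is `(d / |c|)` without a sign; for even `c` it is the extended symbol. -/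
noncomputable def etaMultiplier (a b c d : ℤ) : ℂ :=
  if Odd c then jacobiSym d c.natAbs * zeta24 ^ ((a + d) * c - b * d * (c ^ 2 - 1) - 3 * c)
  else extJacobi c d *
    zeta24 ^ ((a + d) * c - b * d * (c ^ 2 - 1) + 3 * d - 3 - 3 * c * d)

lemma etaMultiplier_of_odd {c : ℤ} (hc : Odd c) (a b d : ℤ) :
    etaMultiplier a b c d =
      jacobiSym d c.natAbs * zeta24 ^ ((a + d) * c - b * d * (c ^ 2 - 1) - 3 * c) :=
  if_pos hc

lemma etaMultiplier_of_even {c : ℤ} (hc : Even c) (a b d : ℤ) :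
    etaMultiplier a b c d = extJacobi c d *
      zeta24 ^ ((a + d) * c - b * d * (c ^ 2 - 1) + 3 * d - 3 - 3 * c * d) :=
  if_neg (by simpa using hc)

lemma twentyFour_dvd_mul_sq_sub_one {c : ℤ} (hc : Odd c) : (24 : ℤ) ∣ c * (c ^ 2 - 1) := by
  obtain ⟨t, rfl⟩ := hc
  have h : ((2 * t + 1) * ((2 * t + 1) ^ 2 - 1)) = 4 * (t * (t + 1) * (2 * t + 1)) := by ring
  rw [h, show (24 : ℤ) = 4 * 6 by norm_num]
  refine mul_dvd_mul_left 4 (Int.dvd_of_emod_eq_zero ?_)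
  have : t % 6 = 0 ∨ t % 6 = 1 ∨ t % 6 = 2 ∨ t % 6 = 3 ∨ t % 6 = 4 ∨ t % 6 = 5 := by lia
  rcases this with h | h | h | h | h | h <;> simp [Int.mul_emod, Int.add_emod, h]

lemma jacobiSym_add_mul_left (n a c : ℤ) :
    jacobiSym (a + n * c) c.natAbs = jacobiSym a c.natAbs := by
  refine jacobiSym.mod_left' (Int.ModEq.symm ?_)
  rw [Int.modEq_iff_dvd]
  simp

/-- Right translation by `T ^ n` leaves `c` fixed, so for odd `c` the symbol `(d / |c|)` is
unchanged and only the exponent has to be compared. -/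
lemma etaMultiplier_mul_T {c : ℤ} (hc : Odd c) {a b d : ℤ} (h : a * d - b * c = 1) (n : ℤ) :
    etaMultiplier a (b + n * a) c (d + n * c) = zeta24 ^ n * etaMultiplier a b c d := by
  rw [etaMultiplier_of_odd hc, etaMultiplier_of_odd hc, jacobiSym_add_mul_left, mul_left_comm,
    ← zpow_add₀ zeta24_ne_zero]
  congr 1
  refine zeta24_zpow_congr ?_
  have : (a + (d + n * c)) * c - (b + n * a) * (d + n * c) * (c ^ 2 - 1) - 3 * c -
      (n + ((a + d) * c - b * d * (c ^ 2 - 1) - 3 * c)) =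
      c * (c ^ 2 - 1) * (-(n * (2 * b + n * a))) := by
    linear_combination (-(c ^ 2 - 1) * n) * h
  rw [this]
  exact (twentyFour_dvd_mul_sq_sub_one hc).mul_right _

lemma chi4_natAbs {d : ℤ} (hd : Odd d) :
    ZMod.χ₄ (d.natAbs : ZMod 4) = if d % 4 = 1 ↔ 0 < d then 1 else -1 := by
  rw [ZMod.χ₄_nat_eq_if_mod_four]
  have := Int.odd_iff.1 hd
  split_ifs <;> lia

/-- Quadratic reciprocity for odd integers of either sign, in the form needed for
`(c, d) ↦ (d, -c)`. -/
lemma jacobiSym_neg_left_eq {c d : ℤ} (hc : Odd c) (hd : Odd d) :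
    jacobiSym (-c) d.natAbs =
      (if d < 0 ∧ 0 ≤ c then -1 else 1) * (if d % 4 = 1 ∨ c % 4 = 3 then 1 else -1) *
        jacobiSym d c.natAbs := by
  have hC : Odd c.natAbs := Int.natAbs_odd.2 hc
  have hD : Odd d.natAbs := Int.natAbs_odd.2 hd
  have hc2 := Int.odd_iff.1 hc
  have hd2 := Int.odd_iff.1 hd
  rw [jacobiSym.neg _ hD, chi4_natAbs hd]
  have key : jacobiSym c.natAbs d.natAbs =
      (if c.natAbs % 4 = 3 ∧ d.natAbs % 4 = 3 then -1 else 1) * jacobiSym d.natAbs c.natAbs := by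
    rw [← jacobiSym.quadratic_reciprocity_if (Nat.odd_iff.1 hC) (Nat.odd_iff.1 hD)]
    split_ifs <;> simp
  have h1 : jacobiSym c d.natAbs = (if 0 < c ∨ (d % 4 = 1 ↔ 0 < d) then 1 else -1) *
      jacobiSym c.natAbs d.natAbs := by
    rcases lt_or_ge 0 c with h0 | h0
    · simp [h0, abs_of_pos h0]
    · conv_lhs => rw [show c = -(c.natAbs : ℤ) by lia]
      rw [jacobiSym.neg _ hD, chi4_natAbs hd]
      simp [h0.not_gt]
  have h2 : jacobiSym d c.natAbs = (if 0 < d ∨ (c % 4 = 1 ↔ 0 < c) then 1 else -1) *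
      jacobiSym d.natAbs c.natAbs := by
    rcases lt_or_ge 0 d with h0 | h0
    · simp [h0, abs_of_pos h0]
    · conv_lhs => rw [show d = -(d.natAbs : ℤ) by lia]
      rw [jacobiSym.neg _ hC, chi4_natAbs hc]
      simp [h0.not_gt]
  rw [h1, h2, key]
  generalize jacobiSym d.natAbs c.natAbs = J
  split_ifs <;> first | ring1 | (exfalso; lia)

/-- The closed formula satisfies the cocycle relation for `γ ↦ γS`, including the branch
correction of `sqrt_mul_sqrt_upperHalfPlane`. Quadratic reciprocity is needed when `c` and `d` are
both odd. -/
lemma etaMultiplier_mul_S {a b c d : ℤ} (h : a * d - b * c = 1) :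
    etaMultiplier b (-a) d (-c) = zeta24 ^ (-3 : ℤ) * (if d < 0 ∧ 0 ≤ c then -1 else 1) *
      etaMultiplier a b c d := by
  rcases Int.even_or_odd c with hc | hc
  · have hd : Odd d := by
      by_contra hd
      rw [Int.not_odd_iff_even] at hd
      obtain ⟨x, rfl⟩ := hc
      obtain ⟨y, rfl⟩ := hd
      have : 2 * (a * y - b * x) = 1 := by linear_combination h
      lia
    rw [etaMultiplier_of_odd hd, etaMultiplier_of_even hc]
    have hJ : jacobiSym (-c) d.natAbs =
        (if d % 4 = 1 then 1 else -1) * (if d < 0 ∧ 0 ≤ c then -1 else 1) * extJacobi c d := by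
      rw [jacobiSym.neg _ (Int.natAbs_odd.2 hd), chi4_natAbs hd, extJacobi]
      have := Int.odd_iff.1 hd
      split_ifs <;> first | ring1 | (exfalso; lia)
    rw [hJ]
    have hd2 := Int.odd_iff.1 hd
    have he : (b + -c) * d - -a * -c * (d ^ 2 - 1) - 3 * d = -3 +
      ((a + d) * c - b * d * (c ^ 2 - 1) + 3 * d - 3 - 3 * c * d) - 6 * (d - 1) := by
      linear_combination (-c * d) * h
    rcases (by lia : d % 4 = 1 ∨ d % 4 = 3) with h4 | h4
    · rw [zeta24_zpow_congr (show (24 : ℤ) ∣ (b + -c) * d - -a * -c * (d ^ 2 - 1) - 3 * d - (-3 +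
        ((a + d) * c - b * d * (c ^ 2 - 1) + 3 * d - 3 - 3 * c * d)) by rw [he]; lia),
        zpow_add₀ zeta24_ne_zero]
      simp only [h4, if_true]
      push_cast
      ring
    · rw [zeta24_zpow_eq_neg (show (24 : ℤ) ∣ (b + -c) * d - -a * -c * (d ^ 2 - 1) - 3 * d - (-3 +
        ((a + d) * c - b * d * (c ^ 2 - 1) + 3 * d - 3 - 3 * c * d) + 12) by rw [he]; lia),
        zpow_add₀ zeta24_ne_zero]
      rw [if_neg (by lia : ¬d % 4 = 1)]
      push_cast
      ring
  rcases Int.even_or_odd d with hd | hd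
  · rw [etaMultiplier_of_odd hc, etaMultiplier_of_even hd]
    have hJ : extJacobi d (-c) = (if d < 0 ∧ 0 ≤ c then -1 else 1) * jacobiSym d c.natAbs := by
      have := Int.odd_iff.1 hc
      rw [extJacobi, Int.natAbs_neg]
      split_ifs <;> first | ring1 | (exfalso; lia)
    rw [hJ, show (b + -c) * d - -a * -c * (d ^ 2 - 1) + 3 * -c - 3 - 3 * d * -c = -3 +
      ((a + d) * c - b * d * (c ^ 2 - 1) - 3 * c) by linear_combination (-c * d) * h,
      zpow_add₀ zeta24_ne_zero]
    push_cast
    ring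
  · rw [etaMultiplier_of_odd hc, etaMultiplier_of_odd hd, jacobiSym_neg_left_eq hc hd]
    have hc2 := Int.odd_iff.1 hc
    have hd2 := Int.odd_iff.1 hd
    have he : (b + -c) * d - -a * -c * (d ^ 2 - 1) - 3 * d = -3 +
      ((a + d) * c - b * d * (c ^ 2 - 1) - 3 * c) + 3 * ((1 - d) * (c + 1)) := by
      linear_combination (-c * d) * h
    obtain ⟨x, rfl⟩ := hc
    obtain ⟨y, rfl⟩ := hd
    have he' : 3 * ((1 - (2 * y + 1)) * (2 * x + 1 + 1)) = -12 * (y * (x + 1)) := by ring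
    rw [he'] at he
    by_cases h4 : (2 * y + 1) % 4 = 1 ∨ (2 * x + 1) % 4 = 3
    · have h2 : (2 : ℤ) ∣ y * (x + 1) := by
        rcases h4 with h4 | h4
        · exact (show (2 : ℤ) ∣ y by lia).mul_right _
        · exact (show (2 : ℤ) ∣ x + 1 by lia).mul_left _
      rw [zeta24_zpow_congr (n := -3 + _) (by rw [he, add_sub_cancel_left]; lia),
        zpow_add₀ zeta24_ne_zero]
      simp only [h4, if_true]
      push_cast
      ring
    · have h2 : (y * (x + 1)) % 2 = 1 := by
        rw [Int.mul_emod, show y % 2 = 1 by lia, show (x + 1) % 2 = 1 by lia]; rfl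
      rw [zeta24_zpow_eq_neg (n := -3 + _) (by rw [he, add_sub_add_left_eq_sub]; lia),
        zpow_add₀ zeta24_ne_zero]
      simp only [h4, if_false]
      push_cast
      ring

/-! ### The transformation law of the eta function -/

/-- The transformation law `η(γz) = ε(γ) √(cz + d) η(z)` on the upper half-plane, for the matrix
`γ = (a b; c d)`, where `ε` is `etaMultiplier`. -/
def EtaTransforms (a b c d : ℤ) : Prop :=
  ∀ z : ℂ, 0 < z.im → ModularForm.eta ((a * z + b) / (c * z + d)) =
    etaMultiplier a b c d * Complex.sqrt (c * z + d) * ModularForm.eta z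

lemma mul_add_ne_zero_of_im_pos {c d : ℤ} (h : c ≠ 0 ∨ d ≠ 0) {z : ℂ} (hz : 0 < z.im) :
    (c * z + d : ℂ) ≠ 0 := by
  intro h0
  have h1 : (c : ℝ) * z.im = 0 := by simpa using congrArg Complex.im h0
  have hc : c = 0 := by exact_mod_cast (mul_eq_zero.1 h1).resolve_right hz.ne'
  subst hc
  simp_all

lemma bottom_row_ne_zero {a b c d : ℤ} (h : a * d - b * c = 1) : c ≠ 0 ∨ d ≠ 0 := by
  by_contra! h0
  simp [h0.1, h0.2] at h

lemma EtaTransforms.mul_T {a b c d : ℤ} (hc : Odd c) (h : a * d - b * c = 1)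
    (H : EtaTransforms a b c d) (n : ℤ) : EtaTransforms a (b + n * a) c (d + n * c) := by
  intro z hz
  have := H (z + n) (by simpa using hz)
  rw [eta_add_intCast] at this
  rw [etaMultiplier_mul_T hc h]
  push_cast
  rw [show (a * z + (b + n * a) : ℂ) = a * (z + n) + b by ring,
    show (c * z + (d + n * c) : ℂ) = c * (z + n) + d by ring, this]
  ring

lemma EtaTransforms.mul_S {a b c d : ℤ} (h : a * d - b * c = 1)
    (H : EtaTransforms a b c d) : EtaTransforms b (-a) d (-c) := by
  intro z hz
  have hz0 : z ≠ 0 := by rintro rfl; simp at hz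
  have him : 0 < (-1 / z).im := by
    simpa [neg_div, Complex.inv_im] using div_pos hz (Complex.normSq_pos.2 hz0)
  have h0 := bottom_row_ne_zero h
  have h1 := mul_add_ne_zero_of_im_pos h0 him
  have h2 := mul_add_ne_zero_of_im_pos (c := d) (d := -c) (by simpa [or_comm] using h0) hz
  have key := sqrt_mul_sqrt_upperHalfPlane h0 hz
  have := H _ him
  rw [eta_neg_inv hz] at this
  rw [etaMultiplier_mul_S h]
  have he : (b * z + (-a : ℤ)) / (d * z + (-c : ℤ)) =
      (a * (-1 / z) + b) / (c * (-1 / z) + d) := by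
    rw [div_eq_div_iff h2 h1]
    push_cast
    field_simp
    ring
  rw [he, this]
  linear_combination (etaMultiplier a b c d * zeta24 ^ (-3 : ℤ) * ModularForm.eta z) * key

lemma EtaTransforms.mul_T_one {a b c d : ℤ} (h : a * d - b * c = 1)
    (H : EtaTransforms a b c d) : EtaTransforms a (b + a) c (d + c) := by
  rcases Int.even_or_odd c with hc | hc
  · have hd : Odd d := by
      by_contra hd
      rw [Int.not_odd_iff_even] at hd
      obtain ⟨x, rfl⟩ := hc
      obtain ⟨y, rfl⟩ := hd
      have : 2 * (a * y - b * x) = 1 := by linear_combination h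
      lia
    -- `T = S T⁻¹ S T⁻¹ S`, and along this word `T⁻¹` is only applied where the lower left entry,
    -- first `d` and then `-c - d`, is odd.
    have h1 := (H.mul_S h).mul_T hd (by linear_combination h) (-1)
    have h2 := h1.mul_S (by linear_combination h)
    have h3 := h2.mul_T (by simpa [sub_eq_add_neg] using hc.neg.sub_odd hd)
      (by linear_combination h) (-1)
    have h4 := h3.mul_S (by linear_combination h)
    convert h4 using 1 <;> ring
  · simpa using H.mul_T hc h 1

lemma EtaTransforms.mul_T_neg_one {a b c d : ℤ} (h : a * d - b * c = 1)
    (H : EtaTransforms a b c d) : EtaTransforms a (b - a) c (d - c) := by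
  -- `T⁻¹ = S T S T S S S`.
  have h1 := (H.mul_S h).mul_T_one (by linear_combination h)
  have h2 := h1.mul_S (by linear_combination h)
  have h3 := h2.mul_T_one (by linear_combination h)
  have h4 := h3.mul_S (by linear_combination h)
  have h5 := h4.mul_S (by linear_combination h)
  have h6 := h5.mul_S (by linear_combination h)
  convert h6 using 1 <;> ring

lemma etaTransforms_one : EtaTransforms 1 0 0 1 := by
  intro z hz
  simp [etaMultiplier, extJacobi]

lemma etaTransforms_entries (g : SL(2, ℤ)) : EtaTransforms (g 0 0) (g 0 1) (g 1 0) (g 1 1) := by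
  have hdet (x : SL(2, ℤ)) : x 0 0 * x 1 1 - x 0 1 * x 1 0 = 1 := by
    rw [← Matrix.det_fin_two, x.2]
  have hg : g ∈ Subgroup.closure {ModularGroup.S, ModularGroup.T} := by
    rw [SpecialLinearGroup.SL2Z_generators]; trivial
  induction hg using Subgroup.closure_induction_right with
  | one => simpa using etaTransforms_one
  | mul_right x hx y hy ih =>
    rcases hy with rfl | rfl
    · convert ih.mul_S (hdet x) using 1 <;>
        simp [ModularGroup.coe_S, Matrix.mul_apply, Fin.sum_univ_two]
    · convert ih.mul_T_one (hdet x) using 1 <;>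
        simp [ModularGroup.coe_T, Matrix.mul_apply, Fin.sum_univ_two, add_comm]
  | mul_inv_cancel x hx y hy ih =>
    rcases hy with rfl | rfl
    · have h1 := ((ih.mul_S (hdet x)).mul_S (by linear_combination hdet x)).mul_S
        (by linear_combination hdet x)
      convert h1 using 1 <;>
        simp [ModularGroup.coe_S, Matrix.mul_apply, Fin.sum_univ_two, Matrix.adjugate_fin_two]
    · convert ih.mul_T_neg_one (hdet x) using 1 <;>
        simp [ModularGroup.coe_T, Matrix.mul_apply, Fin.sum_univ_two,
          Matrix.adjugate_fin_two] <;> ring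

theorem eta_transform {a b c d : ℤ} (h : a * d - b * c = 1) : EtaTransforms a b c d := by
  simpa using etaTransforms_entries ⟨!![a, b; c, d], by rw [Matrix.det_fin_two_of, h]⟩

/-! ### The extended Jacobi symbol of `(-1) ^ k s` -/

lemma jacobiSym_finset_prod {ι : Type*} (s : Finset ι) (f : ι → ℤ) (b : ℕ) :
    jacobiSym (∏ i ∈ s, f i) b = ∏ i ∈ s, jacobiSym (f i) b :=
  map_prod (⟨⟨fun a ↦ jacobiSym a b, jacobiSym.one_left b⟩, fun x y ↦ jacobiSym.mul_left x y b⟩ :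
    ℤ →* ℤ) f s

lemma zpow_eq_pow_toNat_mul_pow_toNat {x : ℂ} (hx : x ^ 2 = 1) (n : ℤ) :
    x ^ n = x ^ n.toNat * x ^ (-n).toNat := by
  have hinv : x⁻¹ = x := inv_eq_of_mul_eq_one_left (by rw [← sq, hx])
  rcases le_total 0 n with h | h
  · obtain ⟨m, rfl⟩ := Int.eq_ofNat_of_zero_le h
    simp
  · obtain ⟨m, hm⟩ := Int.eq_ofNat_of_zero_le (neg_nonneg.2 h)
    obtain rfl : n = -m := by lia
    simp [← inv_pow, hinv]

/-- The extended symbol of `± P / Q` may be computed from any fraction whose denominator is prime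
to `d`: a common factor of `P` and `Q` contributes a square. -/
lemma extJacobiRat_sign_mul_div {e d : ℤ} (he : e = 1 ∨ e = -1) {P Q : ℕ} (hP : P ≠ 0) (hQ : Q ≠ 0)
    (hQd : (Q : ℤ).gcd d.natAbs = 1) :
    extJacobiRat (e * (P / Q)) d =
      (if d < 0 ∧ e < 0 then -1 else 1) * jacobiSym e d.natAbs *
        (jacobiSym P d.natAbs * jacobiSym Q d.natAbs) := by
  set x : ℚ := e * (P / Q) with hx
  have hQ' : (Q : ℚ) ≠ 0 := by exact_mod_cast hQ
  have hcross : x.num * Q = e * P * x.den := by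
    have h1 : (x.num : ℚ) = x * x.den := (Rat.mul_den_eq_num x).symm
    have h2 : x * Q = e * P := by rw [hx]; field_simp
    have : (x.num * Q : ℚ) = e * P * x.den := by rw [h1]; linear_combination (x.den : ℚ) * h2
    exact_mod_cast this
  have hsign : x.num < 0 ↔ e < 0 := by
    have hP' : (0 : ℤ) < P := by lia
    have hQ'' : (0 : ℤ) < Q := by lia
    have hden : (0 : ℤ) < x.den := by exact_mod_cast x.den_pos
    rcases he with rfl | rfl
    · have : 0 < x.num * Q := by rw [hcross]; positivity
      have := pos_of_mul_pos_left this hQ''.le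
      lia
    · have : 0 < -x.num * Q := by
        rw [neg_mul, hcross]; have : 0 < (P : ℤ) * x.den := by positivity
        lia
      have := pos_of_mul_pos_left this hQ''.le
      lia
  have hden : (x.den : ℤ) ∣ Q := by
    have h1 : (x.den : ℤ) ∣ x.num * Q := ⟨e * P, by rw [hcross]; ring⟩
    have h2 : IsCoprime (x.den : ℤ) x.num := by
      rw [Int.isCoprime_iff_gcd_eq_one, Int.gcd_comm, Int.gcd_eq_natAbs]
      simpa using x.reduced
    exact h2.dvd_of_dvd_mul_left h1
  have hdend : (x.den : ℤ).gcd d.natAbs = 1 := by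
    rw [← Int.isCoprime_iff_gcd_eq_one] at hQd ⊢
    exact hQd.of_isCoprime_of_dvd_left hden
  have hJ := congrArg (fun t ↦ jacobiSym t d.natAbs) hcross
  simp only [jacobiSym.mul_left] at hJ
  have h1 := jacobiSym.sq_one hQd
  have h2 := jacobiSym.sq_one hdend
  have key : jacobiSym x.num d.natAbs * jacobiSym x.den d.natAbs =
      jacobiSym e d.natAbs * (jacobiSym P d.natAbs * jacobiSym Q d.natAbs) := by
    linear_combination jacobiSym Q d.natAbs * jacobiSym x.den d.natAbs * hJ -
      jacobiSym x.num d.natAbs * jacobiSym x.den d.natAbs * h1 +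
      jacobiSym Q d.natAbs * jacobiSym e d.natAbs * jacobiSym P d.natAbs * h2
  rw [extJacobiRat, extJacobi, extJacobi, if_neg (show ¬(d < 0 ∧ (x.den : ℤ) < 0) by lia)]
  simp only [hsign]
  rw [mul_assoc, ← key]
  split_ifs <;> ring

/-- The factor `e(k(d - 1)/4)` is the extended symbol `((-1) ^ k / d)`. -/
lemma exists_sign_zeta24_zpow {d : ℤ} (hd : Odd d) (k : ℤ) :
    ∃ e : ℤ, (e = 1 ∨ e = -1) ∧ ((-1 : ℚ) ^ k = e) ∧
      zeta24 ^ (6 * k * (d - 1)) =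
        (((if d < 0 ∧ e < 0 then -1 else 1) * jacobiSym e d.natAbs : ℤ) : ℂ) := by
  rcases Int.even_or_odd k with hk | hk
  · refine ⟨1, Or.inl rfl, by simp [hk.neg_one_zpow], ?_⟩
    obtain ⟨x, rfl⟩ := hk
    obtain ⟨y, rfl⟩ := hd
    rw [zeta24_zpow_eq_one ⟨x * y, by ring⟩]
    simp
  · refine ⟨-1, Or.inr rfl, by simp [hk.neg_one_zpow], ?_⟩
    have h1 : (if d < 0 ∧ (-1 : ℤ) < 0 then -1 else 1) * jacobiSym (-1) d.natAbs =
        if d % 4 = 1 then 1 else -1 := by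
      rw [jacobiSym.at_neg_one (Int.natAbs_odd.2 hd), chi4_natAbs hd]
      have := Int.odd_iff.1 hd
      split_ifs <;> first | rfl | (exfalso; lia)
    rw [h1]
    obtain ⟨x, rfl⟩ := hk
    obtain ⟨y, rfl⟩ := hd
    rcases Int.even_or_odd y with hy | hy
    · obtain ⟨w, rfl⟩ := hy
      rw [zeta24_zpow_eq_one ⟨(2 * x + 1) * w, by ring⟩, if_pos (by lia)]
      simp
    · obtain ⟨w, rfl⟩ := hy
      rw [zeta24_zpow_eq_neg (n := 0) ⟨2 * x * w + x + w, by ring⟩, if_neg (by lia)]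
      simp

/-- The extended symbol `((-1) ^ k s / d)` in the shape in which it comes out of the product of the
eta multipliers. -/
lemma extJacobiRat_etaQuotientS {N : ℕ} (r : ℕ → ℤ) (k : ℤ) {d : ℤ}
    (hd : Odd d) (hdN : IsCoprime d (N : ℤ)) :
    (extJacobiRat ((-1) ^ k * etaQuotientS N r) d : ℂ) = zeta24 ^ (6 * k * (d - 1)) *
      ∏ m ∈ N.divisors, (jacobiSym m d.natAbs : ℂ) ^ r m := by
  have hcop : ∀ m ∈ N.divisors, IsCoprime (m : ℤ) (d.natAbs : ℤ) := fun m hm ↦ by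
    have h := hdN.symm.of_isCoprime_of_dvd_left
      (Int.natCast_dvd_natCast.2 (Nat.dvd_of_mem_divisors hm))
    rwa [Int.natCast_natAbs, IsCoprime.abs_right_iff]
  obtain ⟨e, he, hek, hez⟩ := exists_sign_zeta24_zpow hd k
  set P : ℕ := ∏ m ∈ N.divisors, m ^ (r m).toNat with hPdef
  set Q : ℕ := ∏ m ∈ N.divisors, m ^ (-r m).toNat with hQdef
  have hm0 : ∀ m ∈ N.divisors, m ≠ 0 := fun m hm ↦ (Nat.pos_of_mem_divisors hm).ne'
  have hP : P ≠ 0 := Finset.prod_ne_zero_iff.2 fun m hm ↦ pow_ne_zero _ (hm0 m hm)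
  have hQ : Q ≠ 0 := Finset.prod_ne_zero_iff.2 fun m hm ↦ pow_ne_zero _ (hm0 m hm)
  have hs : etaQuotientS N r = P / Q := by
    rw [etaQuotientS, hPdef, hQdef]
    push_cast
    rw [← Finset.prod_div_distrib]
    refine Finset.prod_congr rfl fun m hm ↦ ?_
    have : (m : ℚ) ≠ 0 := by exact_mod_cast hm0 m hm
    rw [← zpow_natCast, ← zpow_natCast, ← zpow_sub₀ this]
    congr 1
    lia
  have hQd : (Q : ℤ).gcd d.natAbs = 1 := by
    rw [← Int.isCoprime_iff_gcd_eq_one, hQdef]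
    simp only [Nat.cast_prod, Nat.cast_pow]
    exact IsCoprime.prod_left fun m hm ↦ (hcop m hm).pow_left
  rw [hs, hek, extJacobiRat_sign_mul_div he hP hQ hQd, hez]
  push_cast
  congr 1
  rw [hPdef, hQdef]
  push_cast
  rw [jacobiSym_finset_prod, jacobiSym_finset_prod]
  push_cast
  rw [← Finset.prod_mul_distrib]
  refine Finset.prod_congr rfl fun m hm ↦ ?_
  rw [zpow_eq_pow_toNat_mul_pow_toNat, jacobiSym.pow_left, jacobiSym.pow_left]
  · push_cast
    rfl
  · exact_mod_cast jacobiSym.sq_one (Int.isCoprime_iff_gcd_eq_one.1 (hcop m hm))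

/-! ### The multiplier of an eta-quotient on `Γ₀(N)` -/

lemma SL2Z_det_eq (g : SL(2, ℤ)) : g 0 0 * g 1 1 - g 0 1 * g 1 0 = 1 := by
  rw [← Matrix.det_fin_two, g.2]

lemma zpow_finset_sum {ι : Type*} {x : ℂ} (hx : x ≠ 0) (s : Finset ι) (e : ι → ℤ) :
    x ^ ∑ i ∈ s, e i = ∏ i ∈ s, x ^ e i := by
  classical
  induction s using Finset.induction_on with
  | empty => simp
  | insert i s hi ih => rw [Finset.sum_insert hi, Finset.prod_insert hi, zpow_add₀ hx, ih]

/-- The multiplier of the eta-quotient at `γ = (a b; c d)`: the product of the `r m`-th powers of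
the eta multipliers of `(a, mb; c/m, d)`. It is meaningful on `Γ₀(N)`, where the integer division
`c / m` is exact. -/
noncomputable def etaQuotientMultiplier (N : ℕ) (r : ℕ → ℤ) (g : SL(2, ℤ)) : ℂ :=
  ∏ m ∈ N.divisors, etaMultiplier (g 0 0) (m * g 0 1) (g 1 0 / m) (g 1 1) ^ r m

lemma etaQuotient_ne_zero (N : ℕ) (r : ℕ → ℤ) (z : ℍ) : etaQuotient N r z ≠ 0 := by
  refine Finset.prod_ne_zero_iff.2 fun m hm ↦ zpow_ne_zero _ (ModularForm.eta_ne_zero ?_)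
  have : (0 : ℝ) < m := by exact_mod_cast Nat.pos_of_mem_divisors hm
  simpa [upperHalfPlaneSet] using mul_pos this z.im_pos

lemma etaQuotient_mdifferentiable (N : ℕ) (r : ℕ → ℤ) :
    MDifferentiable 𝓘(ℂ) 𝓘(ℂ) (etaQuotient N r) := by
  rw [UpperHalfPlane.mdifferentiable_iff]
  have hd : DifferentiableOn ℂ
      (fun z ↦ ∏ m ∈ N.divisors, ModularForm.eta ((m : ℂ) * z) ^ r m) {z | 0 < z.im} := by
    refine DifferentiableOn.fun_finsetProd fun m hm ↦ fun z hz ↦ ?_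
    have hm : (0 : ℝ) < m := by exact_mod_cast Nat.pos_of_mem_divisors hm
    have hmz : (m : ℂ) * z ∈ upperHalfPlaneSet := by
      simpa [upperHalfPlaneSet] using mul_pos hm hz
    refine DifferentiableAt.differentiableWithinAt ?_
    refine DifferentiableAt.zpow ?_ (Or.inl (ModularForm.eta_ne_zero hmz))
    exact (ModularForm.differentiableAt_eta_of_mem_upperHalfPlaneSet hmz).comp z (by fun_prop)
  refine hd.congr fun z hz ↦ ?_
  simp [etaQuotient, ofComplex_apply_of_im_pos hz]

/-- On `Γ₀(N)` the eta-quotient is an eigenfunction of the slash operators, since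
`m γz = (a (mz) + mb) / ((c/m) (mz) + d)`. All factors share the automorphy factor `√(cz + d)`,
whose `2k`-th power does not depend on the branch. -/
lemma etaQuotient_slash {N : ℕ} {r : ℕ → ℤ} {k : ℤ} (hk : ∑ m ∈ N.divisors, r m = 2 * k)
    {g : SL(2, ℤ)} (hg : g ∈ Gamma0 N) :
    etaQuotient N r ∣[k] g = etaQuotientMultiplier N r g • etaQuotient N r := by
  ext z
  have hdvd : (N : ℤ) ∣ g 1 0 := (ZMod.intCast_zmod_eq_zero_iff_dvd _ _).1 (Gamma0_mem.1 hg)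
  have hdet := SL2Z_det_eq g
  set w : ℂ := g 1 0 * z + g 1 1 with hw
  have hw0 : w ≠ 0 := mul_add_ne_zero_of_im_pos (bottom_row_ne_zero hdet) z.im_pos
  have hsq : Complex.sqrt w ^ (2 : ℤ) = w := by
    rw [sqrt_eq_exp hw0, ← Complex.exp_int_mul]
    push_cast
    rw [mul_div_cancel₀ _ two_ne_zero, Complex.exp_log hw0]
  have hden : denom g z = w := by simp [denom, hw]
  have hs0 : Complex.sqrt w ≠ 0 := by
    intro h
    rw [h] at hsq
    exact hw0 (by simpa using hsq.symm)
  have hval : etaQuotient N r (g • z) =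
      etaQuotientMultiplier N r g * w ^ k * etaQuotient N r z := by
    rw [etaQuotient, etaQuotientMultiplier, ← hsq, ← zpow_mul, ← hk, zpow_finset_sum hs0,
      ← Finset.prod_mul_distrib, etaQuotient, ← Finset.prod_mul_distrib]
    refine Finset.prod_congr rfl fun m hm ↦ ?_
    have hmpos := Nat.pos_of_mem_divisors hm
    have hm0 : (m : ℂ) ≠ 0 := by exact_mod_cast hmpos.ne'
    have hmc : (m : ℤ) ∣ g 1 0 :=
      (Int.natCast_dvd_natCast.2 (Nat.dvd_of_mem_divisors hm)).trans hdvd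
    obtain ⟨c, hc⟩ := hmc
    have hcm : g 1 0 / m = c := by
      rw [hc, Int.mul_ediv_cancel_left _ (by exact_mod_cast hmpos.ne')]
    have him : 0 < ((m : ℂ) * (z : ℂ)).im := by
      have : (0 : ℝ) < m := by exact_mod_cast hmpos
      simpa using mul_pos this z.im_pos
    have key := eta_transform (a := g 0 0) (b := m * g 0 1) (c := c) (d := g 1 1)
      (by linear_combination hdet + (g 0 1) * hc) _ him
    have hwc : (c * (m * z) + g 1 1 : ℂ) = w := by rw [hw, hc]; push_cast; ring
    rw [hwc] at key
    rw [hcm, ← mul_zpow, ← mul_zpow, ← key, coe_specialLinearGroup_apply]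
    congr 2
    simp only [algebraMap_int_eq, eq_intCast, Complex.ofReal_intCast]
    rw [← hw]
    push_cast
    ring
  rw [ModularForm.SL_slash_apply, hden, hval, Pi.smul_apply, smul_eq_mul, mul_right_comm,
    mul_assoc _ (w ^ k), ← zpow_add₀ hw0]
  simp

section Multiplier

variable {N : ℕ} {r : ℕ → ℤ} {k : ℤ}

lemma smul_etaQuotient_injective {x y : ℂ} (h : x • etaQuotient N r = y • etaQuotient N r) :
    x = y := by
  have := congrFun h UpperHalfPlane.I
  simpa [etaQuotient_ne_zero] using this

lemma etaQuotientMultiplier_mul (hk : ∑ m ∈ N.divisors, r m = 2 * k)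
    {g h : SL(2, ℤ)} (hg : g ∈ Gamma0 N) (hh : h ∈ Gamma0 N) :
    etaQuotientMultiplier N r (g * h) =
      etaQuotientMultiplier N r g * etaQuotientMultiplier N r h := by
  apply smul_etaQuotient_injective (N := N) (r := r)
  rw [← etaQuotient_slash hk (mul_mem hg hh), SlashAction.slash_mul, etaQuotient_slash hk hg,
    ModularForm.SL_smul_slash, etaQuotient_slash hk hh, smul_smul]

lemma etaQuotientMultiplier_one (hk : ∑ m ∈ N.divisors, r m = 2 * k) :
    etaQuotientMultiplier N r 1 = 1 := by
  apply smul_etaQuotient_injective (N := N) (r := r)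
  rw [← etaQuotient_slash hk (one_mem _), SlashAction.slash_one, one_smul]

/-- The lower triangular unipotent matrix `(1 0; n 1)`. -/
def lowerUnipotent (n : ℤ) : SL(2, ℤ) := ⟨!![1, 0; n, 1], by simp [Matrix.det_fin_two_of]⟩

lemma coe_lowerUnipotent (n : ℤ) :
    (lowerUnipotent n : Matrix (Fin 2) (Fin 2) ℤ) = !![1, 0; n, 1] := rfl

lemma T_mem_Gamma1 (N : ℕ) : ModularGroup.T ∈ Gamma1 N := by
  simp [Gamma1_mem, ModularGroup.coe_T]

lemma lowerUnipotent_mem_Gamma1 (N : ℕ) : lowerUnipotent N ∈ Gamma1 N := by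
  rw [Gamma1_mem]
  simp [lowerUnipotent]

lemma Gamma1_le_Gamma0 (N : ℕ) : Gamma1 N ≤ Gamma0 N := fun _ hg ↦
  Gamma0_mem.2 ((Gamma1_mem N _).1 hg).2.2

lemma prod_zeta24_zpow_zpow {ι : Type*} (s : Finset ι) (e r : ι → ℤ) :
    ∏ i ∈ s, (zeta24 ^ e i) ^ r i = zeta24 ^ ∑ i ∈ s, e i * r i := by
  rw [zpow_finset_sum zeta24_ne_zero]
  exact Finset.prod_congr rfl fun i _ ↦ (zpow_mul _ _ _).symm

lemma etaQuotientMultiplier_T (N : ℕ) (r : ℕ → ℤ) :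
    etaQuotientMultiplier N r ModularGroup.T = zeta24 ^ ∑ m ∈ N.divisors, (m : ℤ) * r m := by
  rw [etaQuotientMultiplier, ← prod_zeta24_zpow_zpow]
  refine Finset.prod_congr rfl fun m hm ↦ ?_
  congr 1
  simp [ModularGroup.coe_T, etaMultiplier, extJacobi]

lemma etaMultiplier_lowerUnipotent (n : ℕ) : etaMultiplier 1 0 n 1 = zeta24 ^ (-n : ℤ) := by
  rcases Int.even_or_odd (n : ℤ) with h | h
  · rw [etaMultiplier_of_even h]
    rw [show extJacobi n 1 = 1 by simp [extJacobi], Int.cast_one, one_mul]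
    congr 1
    ring
  · rw [etaMultiplier_of_odd h]
    rw [jacobiSym.one_left, Int.cast_one, one_mul]
    congr 1
    ring

lemma sum_mul_apply_div (N : ℕ) (r : ℕ → ℤ) : ∑ m ∈ N.divisors, (m : ℤ) * r (N / m) =
    ∑ m ∈ N.divisors, ((N / m : ℕ) : ℤ) * r m := by
  rw [← Nat.sum_div_divisors N fun m ↦ ((N / m : ℕ) : ℤ) * r m]
  refine Finset.sum_congr rfl fun m hm ↦ ?_
  rw [Nat.div_div_self (Nat.dvd_of_mem_divisors hm) (Nat.mem_divisors.1 hm).2]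

lemma etaQuotientMultiplier_lowerUnipotent (N : ℕ) (r : ℕ → ℤ) :
    etaQuotientMultiplier N r (lowerUnipotent N) =
      zeta24 ^ (-∑ m ∈ N.divisors, (m : ℤ) * r (N / m)) := by
  rw [sum_mul_apply_div, ← Finset.sum_neg_distrib]
  simp only [← neg_mul]
  rw [← prod_zeta24_zpow_zpow]
  refine Finset.prod_congr rfl fun m hm ↦ ?_
  rw [← etaMultiplier_lowerUnipotent]
  simp [lowerUnipotent]

/-! ### The multiplier under the two congruences -/

/-- Each `(c/m / d)` is the product of `(m / d)` and a sign independent of `m`, and this sign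
disappears because the exponents `r m` have even sum. -/
lemma prod_extJacobi_zpow (hk : ∑ m ∈ N.divisors, r m = 2 * k) {c d : ℤ} (hcd : IsCoprime c d)
    (hN : (N : ℤ) ∣ c) :
    ∏ m ∈ N.divisors, (extJacobi (c / m) d : ℂ) ^ r m =
      ∏ m ∈ N.divisors, (jacobiSym m d.natAbs : ℂ) ^ r m := by
  set u : ℤ := (if d < 0 ∧ c < 0 then -1 else 1) * jacobiSym c d.natAbs with hu
  have hgcd {x : ℤ} (hx : x ∣ c) : x.gcd d.natAbs = 1 := by
    rw [← Int.isCoprime_iff_gcd_eq_one, Int.natCast_natAbs, IsCoprime.abs_right_iff]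
    exact hcd.of_isCoprime_of_dvd_left hx
  have hu2 : (u : ℂ) ^ (2 : ℤ) = 1 := by
    have h := jacobiSym.sq_one (hgcd dvd_rfl)
    have : u ^ 2 = 1 := by
      rw [hu, mul_pow, h]
      split_ifs <;> norm_num
    exact_mod_cast this
  have hu0 : (u : ℂ) ≠ 0 := by
    intro h
    rw [h] at hu2
    norm_num at hu2
  have hprod : ∏ m ∈ N.divisors, (u : ℂ) ^ r m = 1 := by
    rw [← zpow_finset_sum hu0, hk, zpow_mul, hu2, one_zpow]
  rw [← one_mul (∏ m ∈ N.divisors, (jacobiSym m d.natAbs : ℂ) ^ r m), ← hprod,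
    ← Finset.prod_mul_distrib]
  refine Finset.prod_congr rfl fun m hm ↦ ?_
  rw [← mul_zpow]
  congr 1
  have hmpos : (0 : ℤ) < m := by exact_mod_cast Nat.pos_of_mem_divisors hm
  obtain ⟨x, hx⟩ := (Int.natCast_dvd_natCast.2 (Nat.dvd_of_mem_divisors hm)).trans hN
  have hcm : c / m = x := by rw [hx, Int.mul_ediv_cancel_left _ hmpos.ne']
  have hsign : x < 0 ↔ c < 0 := by
    rw [hx]
    exact ⟨mul_neg_of_pos_of_neg hmpos, fun h ↦ neg_of_mul_neg_right h hmpos.le⟩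
  have hm2 := jacobiSym.sq_one (hgcd ⟨x, hx⟩)
  rw [hcm, hu, hx, jacobiSym.mul_left, ← hx, extJacobi]
  simp only [hsign]
  rw [← Int.cast_mul]
  congr 1
  split_ifs
  · linear_combination jacobiSym x d.natAbs * hm2
  · linear_combination -jacobiSym x d.natAbs * hm2

/-- If `c / N` is even then every `c / m` is, so only the formula for even lower left entry
enters. The two congruences remove all of the exponent except the part coming from the weight. -/
lemma etaQuotientMultiplier_eq_of_two_mul_dvd (hk : ∑ m ∈ N.divisors, r m = 2 * k)
    (h1 : (24 : ℤ) ∣ ∑ m ∈ N.divisors, (m : ℤ) * r m)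
    (h2 : (24 : ℤ) ∣ ∑ m ∈ N.divisors, (m : ℤ) * r (N / m))
    {g : SL(2, ℤ)} (hg : (2 * N : ℤ) ∣ g 1 0) :
    etaQuotientMultiplier N r g = zeta24 ^ (6 * k * (g 1 1 - 1)) *
      ∏ m ∈ N.divisors, (jacobiSym m (g 1 1).natAbs : ℂ) ^ r m := by
  have hdet := SL2Z_det_eq g
  have hcop : IsCoprime (g 1 0) (g 1 1) := ⟨-g 0 1, g 0 0, by linear_combination hdet⟩
  rw [etaQuotientMultiplier]
  obtain ⟨t, ht⟩ := hg
  generalize g 0 0 = a, g 0 1 = b, g 1 0 = c, g 1 1 = d at *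
  have hcm : ∀ m ∈ N.divisors, c / m = 2 * t * ((N / m : ℕ) : ℤ) ∧
      (m : ℤ) * ((N / m : ℕ) : ℤ) = N := fun m hm ↦ by
    have hmpos : (m : ℤ) ≠ 0 := by exact_mod_cast (Nat.pos_of_mem_divisors hm).ne'
    have h : (m : ℤ) * ((N / m : ℕ) : ℤ) = N := by
      exact_mod_cast Nat.mul_div_cancel' (Nat.dvd_of_mem_divisors hm)
    refine ⟨?_, h⟩
    rw [ht, show (2 * N * t : ℤ) = m * (2 * t * ((N / m : ℕ) : ℤ)) by rw [← h]; ring,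
      Int.mul_ediv_cancel_left _ hmpos]
  rw [← prod_extJacobi_zpow hk hcop ⟨2 * t, by rw [ht]; ring⟩]
  have hstep : ∏ m ∈ N.divisors, etaMultiplier a (m * b) (c / m) d ^ r m =
      ∏ m ∈ N.divisors, (zeta24 ^ ((a + d) * (c / m) - m * b * d * ((c / m) ^ 2 - 1) + 3 * d - 3 -
        3 * (c / m) * d)) ^ r m * (extJacobi (c / m) d : ℂ) ^ r m := by
    refine Finset.prod_congr rfl fun m hm ↦ ?_
    rw [etaMultiplier_of_even, mul_zpow, mul_comm]
    rw [(hcm m hm).1, mul_assoc]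
    exact even_two_mul _
  rw [hstep, Finset.prod_mul_distrib, prod_zeta24_zpow_zpow]
  congr 1
  refine zeta24_zpow_congr ?_
  rw [sum_mul_apply_div] at h2
  have hsum : ∑ m ∈ N.divisors, ((a + d) * (c / m) - m * b * d * ((c / m) ^ 2 - 1) + 3 * d - 3 -
        3 * (c / m) * d) * r m = (2 * t * (a + d - b * d * c - 3 * d)) *
          ∑ m ∈ N.divisors, ((N / m : ℕ) : ℤ) * r m +
        b * d * ∑ m ∈ N.divisors, (m : ℤ) * r m + (3 * d - 3) * ∑ m ∈ N.divisors, r m := by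
    rw [Finset.mul_sum, Finset.mul_sum, Finset.mul_sum, ← Finset.sum_add_distrib,
      ← Finset.sum_add_distrib]
    refine Finset.sum_congr rfl fun m hm ↦ ?_
    obtain ⟨e1, e2⟩ := hcm m hm
    rw [e1, ht]
    linear_combination (-(b * d * r m * 4 * t ^ 2 * ((N / m : ℕ) : ℤ))) * e2
  rw [hsum, hk, show ∀ x y : ℤ, x + y + (3 * d - 3) * (2 * k) - 6 * k * (d - 1) = x + y by
    intros; ring]
  exact dvd_add (h2.mul_left _) (h1.mul_left _)

lemma etaQuotientMultiplier_T_of_dvd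
    (h1 : (24 : ℤ) ∣ ∑ m ∈ N.divisors, (m : ℤ) * r m) :
    etaQuotientMultiplier N r ModularGroup.T = 1 := by
  rw [etaQuotientMultiplier_T, zeta24_zpow_eq_one h1]

lemma etaQuotientMultiplier_lowerUnipotent_of_dvd
    (h2 : (24 : ℤ) ∣ ∑ m ∈ N.divisors, (m : ℤ) * r (N / m)) :
    etaQuotientMultiplier N r (lowerUnipotent N) = 1 := by
  rw [etaQuotientMultiplier_lowerUnipotent, zeta24_zpow_eq_one (dvd_neg.2 h2)]

lemma dvd_of_mem_Gamma0 {g : SL(2, ℤ)} (hg : g ∈ Gamma0 N) : (N : ℤ) ∣ g 1 0 :=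
  (ZMod.intCast_zmod_eq_zero_iff_dvd _ _).1 (Gamma0_mem.1 hg)

/-- For odd `d` the multiplier is `((-1) ^ k s / d)`. When `c / N` is odd, multiplication on the
right by `(1 0; N 1)`, which has multiplier `1`, makes it even without changing `d`. -/
lemma etaQuotientMultiplier_eq_extJacobiRat (hk : ∑ m ∈ N.divisors, r m = 2 * k)
    (h1 : (24 : ℤ) ∣ ∑ m ∈ N.divisors, (m : ℤ) * r m)
    (h2 : (24 : ℤ) ∣ ∑ m ∈ N.divisors, (m : ℤ) * r (N / m))
    {g : SL(2, ℤ)} (hg : g ∈ Gamma0 N) (hd : Odd (g 1 1)) :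
    etaQuotientMultiplier N r g =
      (extJacobiRat ((-1) ^ k * etaQuotientS N r) (g 1 1) : ℂ) := by
  have hdet := SL2Z_det_eq g
  obtain ⟨t, ht⟩ := dvd_of_mem_Gamma0 hg
  rw [extJacobiRat_etaQuotientS r k hd ⟨g 0 0, -g 0 1 * t, by linear_combination hdet + g 0 1 * ht⟩]
  rcases Int.even_or_odd t with hte | hto
  · obtain ⟨x, rfl⟩ := hte
    exact etaQuotientMultiplier_eq_of_two_mul_dvd hk h1 h2 ⟨x, by rw [ht]; ring⟩
  · have hL := Gamma1_le_Gamma0 N (lowerUnipotent_mem_Gamma1 N)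
    have h11 : (g * lowerUnipotent N) 1 1 = g 1 1 := by
      simp [coe_lowerUnipotent, Matrix.mul_apply, Fin.sum_univ_two]
    have h10 : (g * lowerUnipotent N) 1 0 = N * (t + g 1 1) := by
      simp [coe_lowerUnipotent, Matrix.mul_apply, Fin.sum_univ_two, ht]
      ring
    obtain ⟨x, hx⟩ := hto.add_odd hd
    have := etaQuotientMultiplier_eq_of_two_mul_dvd hk h1 h2 (g := g * lowerUnipotent N)
      ⟨x, by rw [h10, hx]; ring⟩
    rwa [h11, etaQuotientMultiplier_mul hk hg hL, etaQuotientMultiplier_lowerUnipotent_of_dvd h2,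
      mul_one] at this

lemma etaQuotientMultiplier_T_zpow (hk : ∑ m ∈ N.divisors, r m = 2 * k)
    (h1 : (24 : ℤ) ∣ ∑ m ∈ N.divisors, (m : ℤ) * r m)
    {g : SL(2, ℤ)} (hg : g ∈ Gamma0 N) (n : ℤ) :
    etaQuotientMultiplier N r (g * ModularGroup.T ^ n) = etaQuotientMultiplier N r g := by
  have hT := Gamma1_le_Gamma0 N (T_mem_Gamma1 N)
  have step (h : SL(2, ℤ)) (hh : h ∈ Gamma0 N) : etaQuotientMultiplier N r (h * ModularGroup.T) =
      etaQuotientMultiplier N r h := by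
    rw [etaQuotientMultiplier_mul hk hh hT, etaQuotientMultiplier_T_of_dvd h1, mul_one]
  induction n with
  | zero => simp
  | succ n ih => rw [zpow_add_one, ← mul_assoc, step _ (mul_mem hg (zpow_mem hT _)), ih]
  | pred n ih =>
    rw [← ih, ← step _ (mul_mem hg (zpow_mem hT (-n - 1))), mul_assoc, ← zpow_add_one,
      sub_add_cancel]

/-- On `Γ₁(N)` the multiplier is trivial. For odd `d = 1 + tN` it depends on `d` alone, and
`(1 0; N 1) T ^ t` has the same `d` and multiplier `1`. For even `d`, the entry `c` is odd and
`γT` has odd lower right entry. -/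
lemma etaQuotientMultiplier_of_mem_Gamma1 (hk : ∑ m ∈ N.divisors, r m = 2 * k)
    (h1 : (24 : ℤ) ∣ ∑ m ∈ N.divisors, (m : ℤ) * r m)
    (h2 : (24 : ℤ) ∣ ∑ m ∈ N.divisors, (m : ℤ) * r (N / m))
    {g : SL(2, ℤ)} (hg : g ∈ Gamma1 N) : etaQuotientMultiplier N r g = 1 := by
  have odd_case (h : SL(2, ℤ)) (hh : h ∈ Gamma1 N) (hd : Odd (h 1 1)) :
      etaQuotientMultiplier N r h = 1 := by
    have h11 : ((h 1 1 : ℤ) : ZMod N) = (1 : ℤ) := by simpa using ((Gamma1_mem N h).1 hh).2.1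
    obtain ⟨t, ht⟩ := (ZMod.intCast_eq_intCast_iff_dvd_sub _ _ _).1 h11.symm
    have hL := Gamma1_le_Gamma0 N (lowerUnipotent_mem_Gamma1 N)
    have hT := Gamma1_le_Gamma0 N (T_mem_Gamma1 N)
    have he : (lowerUnipotent N * ModularGroup.T ^ t) 1 1 = h 1 1 := by
      simp [coe_lowerUnipotent, Matrix.mul_apply, Fin.sum_univ_two, ModularGroup.coe_T_zpow]
      linear_combination -ht
    have hw := etaQuotientMultiplier_eq_extJacobiRat hk h1 h2 (mul_mem hL (zpow_mem hT t))
      (by rwa [he])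
    rw [etaQuotientMultiplier_eq_extJacobiRat hk h1 h2 (Gamma1_le_Gamma0 N hh) hd, ← he, ← hw,
      etaQuotientMultiplier_T_zpow hk h1 hL, etaQuotientMultiplier_lowerUnipotent_of_dvd h2]
  rcases Int.even_or_odd (g 1 1) with hd | hd
  · have hdet := SL2Z_det_eq g
    have hc : Odd (g 1 0) := by
      by_contra hc
      rw [Int.not_odd_iff_even] at hc
      obtain ⟨x, hx⟩ := hc
      obtain ⟨y, hy⟩ := hd
      have : 2 * (g 0 0 * y - g 0 1 * x) = 1 := by
        rw [hx, hy] at hdet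
        linear_combination hdet
      lia
    rw [← etaQuotientMultiplier_T_zpow hk h1 (Gamma1_le_Gamma0 N hg) 1, zpow_one]
    refine odd_case _ (mul_mem hg (T_mem_Gamma1 N)) ?_
    have : (g * ModularGroup.T) 1 1 = g 1 0 + g 1 1 := by
      simp [Matrix.mul_apply, Fin.sum_univ_two, ModularGroup.coe_T]
    rw [this]
    exact hc.add_even hd
  · exact odd_case g hg hd

/-! ### The Nebentypus character -/

lemma exists_mem_Gamma0_lower_right {d : ℤ} (hd : IsCoprime d (N : ℤ)) :
    ∃ g ∈ Gamma0 N, g 1 1 = d := by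
  obtain ⟨a, b, h⟩ := hd
  let g : SL(2, ℤ) := ⟨!![a, -b; N, d], by rw [Matrix.det_fin_two_of]; linear_combination h⟩
  have h10 : g 1 0 = N := rfl
  exact ⟨g, Gamma0_mem.2 (by rw [h10]; simp), rfl⟩

lemma exists_mem_Gamma0_of_unit (hN : 0 < N) (u : (ZMod N)ˣ) :
    ∃ g ∈ Gamma0 N, ((g 1 1 : ℤ) : ZMod N) = u := by
  have : NeZero N := ⟨hN.ne'⟩
  obtain ⟨g, hg, h⟩ := exists_mem_Gamma0_lower_right (N := N) (d := ((u : ZMod N).val : ℤ))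
    (Nat.isCoprime_iff_coprime.2 (ZMod.val_coe_unit_coprime u))
  exact ⟨g, hg, by rw [h]; simp⟩

lemma isUnit_lower_right {g : SL(2, ℤ)} (hg : g ∈ Gamma0 N) :
    IsUnit ((g 1 1 : ℤ) : ZMod N) := by
  have h : ((g 0 0 * g 1 1 - g 0 1 * g 1 0 : ℤ) : ZMod N) = 1 := by rw [SL2Z_det_eq]; simp
  push_cast at h
  rw [Gamma0_mem.1 hg, mul_zero, sub_zero] at h
  exact IsUnit.of_mul_eq_one _ (by rw [mul_comm, h])

lemma mul_inv_mem_Gamma1 {g h : SL(2, ℤ)} (hg : g ∈ Gamma0 N) (hh : h ∈ Gamma0 N)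
    (hd : ((g 1 1 : ℤ) : ZMod N) = (h 1 1 : ℤ)) : g * h⁻¹ ∈ Gamma1 N := by
  have hx : (⟨g, hg⟩ * ⟨h, hh⟩⁻¹ : Gamma0 N) ∈ Gamma1' N := by
    rw [Gamma1_mem']
    have h1 : Gamma0Map N (⟨g, hg⟩ * ⟨h, hh⟩⁻¹) * Gamma0Map N ⟨h, hh⟩ = Gamma0Map N ⟨g, hg⟩ := by
      rw [← map_mul, inv_mul_cancel_right]
    have h2 : Gamma0Map N ⟨h, hh⟩ = Gamma0Map N ⟨g, hg⟩ := hd.symm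
    rw [← h2] at h1
    exact (isUnit_lower_right hh).mul_eq_right.1 h1
  rw [Gamma1_mem]
  exact (Gamma1_to_Gamma0_mem _).1 hx

lemma etaQuotientMultiplier_congr (hk : ∑ m ∈ N.divisors, r m = 2 * k)
    (h1 : (24 : ℤ) ∣ ∑ m ∈ N.divisors, (m : ℤ) * r m)
    (h2 : (24 : ℤ) ∣ ∑ m ∈ N.divisors, (m : ℤ) * r (N / m))
    {g h : SL(2, ℤ)} (hg : g ∈ Gamma0 N) (hh : h ∈ Gamma0 N)
    (hd : ((g 1 1 : ℤ) : ZMod N) = (h 1 1 : ℤ)) :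
    etaQuotientMultiplier N r g = etaQuotientMultiplier N r h := by
  have hx := mul_inv_mem_Gamma1 hg hh hd
  have := etaQuotientMultiplier_mul hk (Gamma1_le_Gamma0 N hx) hh
  rwa [inv_mul_cancel_right, etaQuotientMultiplier_of_mem_Gamma1 hk h1 h2 hx, one_mul] at this

lemma lower_right_mul {g h : SL(2, ℤ)} (hg : g ∈ Gamma0 N) (hh : h ∈ Gamma0 N) :
    (((g * h) 1 1 : ℤ) : ZMod N) = (g 1 1 : ℤ) * (h 1 1 : ℤ) :=
  map_mul (Gamma0Map N) ⟨g, hg⟩ ⟨h, hh⟩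

/-- The multiplier on `Γ₀(N)` is trivial on `Γ₁(N)`, so it descends to a character of
`Γ₀(N) / Γ₁(N) ≃ (ℤ/N)ˣ` through the lower right entry. -/
lemma exists_isNebentypus (hN : 0 < N) (hk : ∑ m ∈ N.divisors, r m = 2 * k)
    (h1 : (24 : ℤ) ∣ ∑ m ∈ N.divisors, (m : ℤ) * r m)
    (h2 : (24 : ℤ) ∣ ∑ m ∈ N.divisors, (m : ℤ) * r (N / m)) :
    ∃ χ : DirichletCharacter ℂ N, IsNebentypus N k (etaQuotient N r) χ := by
  choose L hL hLd using exists_mem_Gamma0_of_unit (N := N) hN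
  let φ : (ZMod N)ˣ →* ℂ :=
    { toFun := fun u ↦ etaQuotientMultiplier N r (L u)
      map_one' := by
        rw [← etaQuotientMultiplier_one hk]
        exact etaQuotientMultiplier_congr hk h1 h2 (hL 1) (one_mem _) (by rw [hLd]; simp)
      map_mul' := fun u w ↦ by
        rw [← etaQuotientMultiplier_mul hk (hL u) (hL w)]
        refine etaQuotientMultiplier_congr hk h1 h2 (hL _) (mul_mem (hL u) (hL w)) ?_
        rw [lower_right_mul (hL u) (hL w), hLd, hLd, hLd, Units.val_mul] }
  refine ⟨MulChar.ofUnitHom φ.toHomUnits, fun g hg ↦ ?_⟩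
  obtain ⟨u, hu⟩ := isUnit_lower_right hg
  rw [etaQuotient_slash hk hg, ← hu, MulChar.ofUnitHom_coe]
  congr 1
  exact etaQuotientMultiplier_congr hk h1 h2 hg (hL u) (by rw [hLd, hu])

end Multiplier

theorem theorem1p1 (N : ℕ) (hN : 0 < N) (r : ℕ → ℤ) (k : ℤ)
    (hk : ∑ m ∈ N.divisors, r m = 2 * k) :
    (IsWeaklyHolomorphicModularForm (Gamma1 N) k (etaQuotient N r) ↔
      (∑ m ∈ N.divisors, (m : ℤ) * r m ≡ 0 [ZMOD 24] ∧
        ∑ m ∈ N.divisors, (m : ℤ) * r (N / m) ≡ 0 [ZMOD 24])) ∧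
    (IsWeaklyHolomorphicModularForm (Gamma1 N) k (etaQuotient N r) →
      (∃! χ : DirichletCharacter ℂ N, IsNebentypus N k (etaQuotient N r) χ) ∧
      ∀ χ : DirichletCharacter ℂ N, IsNebentypus N k (etaQuotient N r) χ →
        ∀ d : ℤ, Odd d → IsCoprime d (N : ℤ) →
          χ (d : ZMod N) = (extJacobiRat ((-1) ^ k * etaQuotientS N r) d : ℂ)) := by
  simp only [Int.modEq_zero_iff_dvd]
  have iff : IsWeaklyHolomorphicModularForm (Gamma1 N) k (etaQuotient N r) ↔
      ((24 : ℤ) ∣ ∑ m ∈ N.divisors, (m : ℤ) * r m ∧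
        (24 : ℤ) ∣ ∑ m ∈ N.divisors, (m : ℤ) * r (N / m)) := by
    refine ⟨fun hf ↦ ?_, fun ⟨h1, h2⟩ ↦ ⟨etaQuotient_mdifferentiable N r, fun g hg ↦ ?_⟩⟩
    · have one_of_mem {g : SL(2, ℤ)} (hg : g ∈ Gamma1 N) : etaQuotientMultiplier N r g = 1 := by
        apply smul_etaQuotient_injective (N := N) (r := r)
        rw [← etaQuotient_slash hk (Gamma1_le_Gamma0 N hg), hf.slash_eq g hg, one_smul]
      have hT := one_of_mem (T_mem_Gamma1 N)
      have hL := one_of_mem (lowerUnipotent_mem_Gamma1 N)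
      rw [etaQuotientMultiplier_T, zeta24_zpow_eq_one_iff] at hT
      rw [etaQuotientMultiplier_lowerUnipotent, zeta24_zpow_eq_one_iff, dvd_neg] at hL
      exact ⟨hT, hL⟩
    · rw [etaQuotient_slash hk (Gamma1_le_Gamma0 N hg),
        etaQuotientMultiplier_of_mem_Gamma1 hk h1 h2 hg, one_smul]
  refine ⟨iff, fun hf ↦ ?_⟩
  obtain ⟨h1, h2⟩ := iff.1 hf
  have value {χ : DirichletCharacter ℂ N} (hχ : IsNebentypus N k (etaQuotient N r) χ)
      {g : SL(2, ℤ)} (hg : g ∈ Gamma0 N) :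
      χ ((g 1 1 : ℤ) : ZMod N) = etaQuotientMultiplier N r g :=
    smul_etaQuotient_injective (N := N) (r := r) (by rw [← hχ g hg, etaQuotient_slash hk hg])
  refine ⟨existsUnique_of_exists_of_unique (exists_isNebentypus hN hk h1 h2)
    fun χ ψ hχ hψ ↦ ?_, fun χ hχ d hd hdN ↦ ?_⟩
  · refine MulChar.ext fun u ↦ ?_
    obtain ⟨g, hg, hu⟩ := exists_mem_Gamma0_of_unit hN u
    rw [← hu, value hχ hg, value hψ hg]
  · obtain ⟨g, hg, rfl⟩ := exists_mem_Gamma0_lower_right hdN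
    rw [value hχ hg, etaQuotientMultiplier_eq_extJacobiRat hk h1 h2 hg hd]
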